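/- Let $\alpha$ be a positive integer. In the $\alpha$-lazy on-line bipartite matching game on a finite set $D$ known in advance, there are finitely many rounds. In each round Builder presents a new vertex $u$ with its neighbourhood $N(u)\subseteq D$, and Scheduler chooses a set $m(u)\subseteq N(u)$ with $|m(u)|\le\alpha$; then $m(x)$ is replaced by $m(x)\setminus m(u)$ for every vertex $x$ presented before. The size $n$ of the game is the maximum size of a matching in the revealed bipartite graph, and the size of the matching constructed by Scheduler is the number of presented vertices $u$ with $m(u)\neq\emptyset$ at the end. For a deterministic algorithm $\mathcal A$ of Scheduler, $\mathrm{Val}_{\mathcal A}(n)$ is the minimum size of the matching that $\mathcal A$ constructs in a game of size $n$ (over all $D$ and all plays of Builder), and $\mathrm{Val}_\alpha(n)$ is the maximum of $\mathrm{Val}_{\mathcal A}(n)$ over all deterministic algorithms $\mathcal A$ that obey the rules of the $\alpha$-lazy game. The algorithm $\alpha$-Bal proceeds as follows when $u$ is presented. At any moment, an element $d\in D$ is available for $u$ if $d\in N(u)$ and no earlier vertex $x$ has $m(x)=\{d\}$; it is strongly available if moreover it belongs to no $m(x)$; a vertex $e$ is ready for $u$ if $m(e)$ contains an element available for $u$.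 First $m(u)$ is set to be any $\min(\alpha,s)$ of the $s$ elements that are strongly available for $u$. Then, as long as there is a vertex $e$ that is ready for $u$ and satisfies $|m(u)|+2\le|m(e)|$, the algorithm picks such an $e$ with $|m(e)|$ maximal and moves one element available for $u$ from $m(e)$ to $m(u)$. Theorem. $\alpha$-Bal is an optimal strategy for Scheduler in the $\alpha$-lazy matching game: $\alpha$-Bal is well defined and, however the choices left open in its description are resolved, it obeys the rules of the $\alpha$-lazy game and, for every $n\ge 0$, $$\mathrm{Val}_{\alpha\text{-Bal}}(n)=\mathrm{Val}_\alpha(n).$$ -/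

import Mathlib

namespace LazyMatching

section Game

variable {D : Type*} [DecidableEq D]

/-- A deterministic strategy of Scheduler on the set `D`. Its arguments are the neighbourhoods of the
vertices presented so far (most recent first) and the neighbourhood `N(u)` of the vertex `u` that is
presented now; its value is the set `m(u)` assigned to `u`. Scheduler's earlier moves need not be
arguments, since they are determined by the earlier neighbourhoods. -/
abbrev Strategy (D : Type*) : Type _ := List (Finset D) → Finset D → Finset D

/-- A play of Builder is the list of the neighbourhoods of the presented vertices, most recent first.
The vertices are named `0, 1, 2, …` in the order of presentation; `nbhd h x` is the neighbourhood
of the vertex `x` (empty if `x` has not been presented). -/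
def nbhd : List (Finset D) → ℕ → Finset D
  | [] => fun _ => ∅
  | N :: past => fun x => if x = past.length then N else nbhd past x

/-- `groups σ h x` is the set `m(x)` after the play `h` of Builder against the strategy `σ`
(empty if `x` has not been presented): the new vertex receives the set chosen by `σ`,
and this set is removed from `m(x)` for every vertex `x` presented before. -/
def groups (σ : Strategy D) : List (Finset D) → ℕ → Finset D
  | [] => fun _ => ∅
  | N :: past => fun x =>
      if x = past.length then σ past N else groups σ past x \ σ past N

/-- The size of the matching constructed by Scheduler: the number of presented vertices `x`
with `m(x)` nonempty at the end. -/
def matched (σ : Strategy D) (h : List (Finset D)) : ℕ :=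
  ((Finset.range h.length).filter fun x => (groups σ h x).Nonempty).card

/-- `M` is a matching in the bipartite graph `(U, D, E)` revealed by the play `h`:
a set of edges no two of which share an endpoint. -/
def IsMatching (h : List (Finset D)) (M : Finset (ℕ × D)) : Prop :=
  (∀ e ∈ M, e.1 < h.length ∧ e.2 ∈ nbhd h e.1) ∧
    Set.InjOn Prod.fst (M : Set (ℕ × D)) ∧ Set.InjOn Prod.snd (M : Set (ℕ × D))

/-- The size of the game is `n`: the largest matching in the revealed graph has `n` edges. -/
def HasSize (h : List (Finset D)) (n : ℕ) : Prop :=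
  IsGreatest {k | ∃ M : Finset (ℕ × D), IsMatching h M ∧ M.card = k} n

end Game

section Balance

variable {D : Type*} [Fintype D] [DecidableEq D]

/-! One round of the balancing algorithm. The vertices `x < t` were presented before, with current
sets `m x`, and the new vertex `u = t` has neighbourhood `N`. During the round, `S` is the current
value of `m(u)`, and the current value of `m(x)` for `x < t` is `m x \ S`, as every element
put into `m(u)` leaves the set it was in. -/

/-- `d` is available for `u`: it is a neighbour of `u` and no earlier vertex `x` has
`m(x) = {d}`. -/
def Available (m : ℕ → Finset D) (t : ℕ) (N S : Finset D) (d : D) : Prop :=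
  d ∈ N ∧ ∀ x < t, m x \ S ≠ {d}

/-- `d` is strongly available for `u` at the beginning of the round (when `m(u) = ∅`): it is
available and belongs to no `m(x)`. -/
def StronglyAvailable (m : ℕ → Finset D) (t : ℕ) (N : Finset D) (d : D) : Prop :=
  Available m t N ∅ d ∧ ∀ x < t, d ∉ m x

/-- The vertex `e` is ready for `u`: the set `m(e)` contains an element that is available for `u`. -/
def Ready (m : ℕ → Finset D) (t : ℕ) (N S : Finset D) (e : ℕ) : Prop :=
  ∃ d ∈ m e \ S, Available m t N S d

/-- The condition of the loop: `e` is ready for `u` and `|m(u)| + 2 ≤ |m(e)|`.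
(The vertex `u` itself never satisfies the inequality.) -/
def Candidate (m : ℕ → Finset D) (t : ℕ) (N S : Finset D) (e : ℕ) : Prop :=
  e < t ∧ Ready m t N S e ∧ S.card + 2 ≤ (m e \ S).card

open Classical in
/-- The initial step: `m(u)` becomes a set of strongly available elements, as many as there are,
but at most `α`. -/
def BalStart (α : ℕ) (m : ℕ → Finset D) (t : ℕ) (N S : Finset D) : Prop :=
  (∀ d ∈ S, StronglyAvailable m t N d) ∧
    S.card = min α (Finset.univ.filter fun d => StronglyAvailable m t N d).card

/-- One pass through the loop: among all candidates, an `e` with `m(e)` of maximal size is picked,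
and one element of `m(e)` that is available for `u` is moved from `m(e)` to `m(u)`. -/
def BalStep (m : ℕ → Finset D) (t : ℕ) (N S S' : Finset D) : Prop :=
  ∃ e, Candidate m t N S e ∧
    (∀ e', Candidate m t N S e' → (m e' \ S).card ≤ (m e \ S).card) ∧
    ∃ d ∈ m e \ S, Available m t N S d ∧ S' = insert d S

/-- `S` is a possible value of `m(u)` at the end of the round: the initial step, then passes through
the loop until there is no candidate any more. -/
def BalRound (α : ℕ) (m : ℕ → Finset D) (t : ℕ) (N S : Finset D) : Prop :=
  (∃ S₀, BalStart α m t N S₀ ∧ Relation.ReflTransGen (BalStep m t N) S₀ S) ∧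
    ∀ e, ¬ Candidate m t N S e

end Balance

/-- A deterministic algorithm for Scheduler. The set `D` is known in advance: for every `d` there is
a strategy for the game on a set of `d` elements. -/
abbrev Algorithm : Type := (d : ℕ) → Strategy (Fin d)

/-- `A` obeys the rules of the `α`-lazy game: `m(u) ⊆ N(u)` and `|m(u)| ≤ α`. -/
def IsLazy (α : ℕ) (A : Algorithm) : Prop :=
  ∀ (d : ℕ) (past : List (Finset (Fin d))) (N : Finset (Fin d)),
    A d past N ⊆ N ∧ (A d past N).card ≤ α

/-- `A` is the `α`-balancing algorithm, with some rule for the choices which its description leaves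
open: every round is a round of the balancing algorithm. -/
def IsBal (α : ℕ) (A : Algorithm) : Prop :=
  ∀ (d : ℕ) (past : List (Finset (Fin d))) (N : Finset (Fin d)),
    BalRound α (groups (A d) past) past.length N (A d past N)

/-- `v` is the worst-case size of the matching constructed by `A`: the minimum over all games of
size `n`, with an arbitrary finite set `D` and an arbitrary finite number of rounds. -/
def IsWorstValue (A : Algorithm) (n v : ℕ) : Prop :=
  IsLeast {k | ∃ (d : ℕ) (h : List (Finset (Fin d))), HasSize h n ∧ matched (A d) h = k} v

/-- `v` is the value of the `α`-lazy matching problem: the maximum of the worst-case values for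
games of size `n` among all algorithms that obey the rules of the `α`-lazy game. -/
def IsLazyValue (α n v : ℕ) : Prop :=
  IsGreatest {w | ∃ B : Algorithm, IsLazy α B ∧ IsWorstValue B n w} v

end LazyMatching

/-!
Fix a play of Builder against the balancing algorithm and call the sets `m(x)` at its end groups.
Let `Z_j` be the union of the groups of size at most `j`, `K_j` the number of vertices with a group
larger than `j`, and `Y_j` the number of vertices with a neighbour outside `Z_j`. These numbers,
for `0 ≤ j ≤ α`, are all that matters:

* Every edge has its end in `Z_j` or starts at one of the `Y_j` vertices, so the size `n` of the game
  is at most `|Z_j| + Y_j` (`IsMatching.card_le_cover`).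
* `|Z_{j+1}| ≤ |Z_j| + (j + 1) (K_j - K_{j+1})` (`card_smallUnion_succ_le`), `Z_0 = ∅`, `K_α = 0`, and
  `K_0` is the size of the matching constructed.
* `j Y_j ≤ |Z_j| + j K_j` (`mul_card_not_subset_le`). This is where balancing enters. An element only
  ever moves to a smaller group, so the sets `Z_j` grow during the game. If a vertex has a small group
  and a neighbour outside `Z_j`, it must have received at least `j` elements at first. When its
  group reaches size at most `j`, at least `j` elements which can be charged to it enter `Z_j`
  (`IsBalanced.exists_isCharged`).

Conversely, any numbers with these properties give Builder a strategy against an arbitrary lazy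
algorithm (`exists_play`). He maintains a set `E` of active elements. For `j = α, …, 0`, when
`min(Y_j, n)` vertices have been presented, he shrinks `E` to `|Z_j|` elements; until the next shrinking,
every new vertex has neighbourhood `E`. By choosing the elements that stay so that small groups
survive, he can keep the number of groups not contained in `E` at most `K_j`
(`exists_phase`): if the smallest groups were too large to fit into `|Z_j|` elements, then all others
would have more than `j` elements, and together they would not fit into the previous `E`.
As `Z_0 = ∅`, at most `K_0` vertices are matched at the end. The inequalities `n ≤ |Z_j| + Y_j` say
that the `x`-th vertex has at least `n - x` neighbours, so by Hall's theorem the game has size `n`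
(`hasSize_length`).

Hence no algorithm has a larger value than the balancing algorithm.
-/

namespace LazyMatching

/-! ### Groups, matchings and sizes of games -/

section General

variable {D : Type*}

theorem IsMatching.card_le_length {h : List (Finset D)} {M : Finset (ℕ × D)}
    (hM : IsMatching h M) : M.card ≤ h.length := by
  rw [← Finset.card_image_of_injOn hM.2.1, ← Finset.card_range h.length]
  refine Finset.card_le_card fun x hx => ?_
  obtain ⟨e, he, rfl⟩ := Finset.mem_image.1 hx
  exact Finset.mem_range.2 (hM.1 e he).1

variable [DecidableEq D]

theorem disjoint_groups (σ : Strategy D) (h : List (Finset D)) {x y : ℕ} (hxy : x ≠ y) :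
    Disjoint (groups σ h x) (groups σ h y) := by
  induction h with
  | nil => simp [groups]
  | cons N past ih =>
    simp only [groups]
    split_ifs with h₁ h₂ h₂
    · omega
    · exact Finset.disjoint_sdiff
    · exact Finset.sdiff_disjoint
    · exact ih.mono Finset.sdiff_subset Finset.sdiff_subset

theorem card_groups_le {α : ℕ} {σ : Strategy D} (hσ : ∀ past N, (σ past N).card ≤ α)
    (h : List (Finset D)) (x : ℕ) : (groups σ h x).card ≤ α := by
  induction h with
  | nil => simp [groups]
  | cons N past ih =>
    simp only [groups]
    split_ifs
    · exact hσ past N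
    · exact (Finset.card_le_card Finset.sdiff_subset).trans ih

/-- The easy half of Kőnig's theorem: a set `Z` together with the vertices that have a neighbour
outside `Z` covers all the edges. -/
theorem IsMatching.card_le_cover {h : List (Finset D)} {M : Finset (ℕ × D)}
    (hM : IsMatching h M) (Z : Finset D) :
    M.card ≤ Z.card + ((Finset.range h.length).filter fun x => ¬ nbhd h x ⊆ Z).card := by
  rw [← Finset.card_filter_add_card_filter_not (s := M) (fun e => e.2 ∈ Z)]
  refine add_le_add ?_ ?_
  · refine Finset.card_le_card_of_injOn Prod.snd (fun e he => (Finset.mem_filter.1 he).2) ?_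
    exact hM.2.2.mono fun e he => (Finset.mem_filter.1 he).1
  · refine Finset.card_le_card_of_injOn Prod.fst (fun e he => ?_)
      (hM.2.1.mono fun e he => (Finset.mem_filter.1 he).1)
    obtain ⟨he, hZ⟩ := Finset.mem_filter.1 he
    exact Finset.mem_filter.2 ⟨Finset.mem_range.2 (hM.1 e he).1, fun hs => hZ (hs (hM.1 e he).2)⟩

/-- If the `x`-th of `n` vertices has at least `n - x` neighbours, then all vertices can be matched:
Hall's condition for a set of vertices follows from the neighbourhood of its first vertex. -/
theorem hasSize_length (h : List (Finset D))
    (hn : ∀ x < h.length, h.length ≤ (nbhd h x).card + x) : HasSize h h.length := by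
  refine ⟨?_, ?_⟩
  · obtain ⟨f, hf, hmem⟩ := (Finset.all_card_le_biUnion_card_iff_exists_injective
      (fun i : Fin h.length => nbhd h i)).1 (by
        intro s
        rcases s.eq_empty_or_nonempty with rfl | hs
        · simp
        have h₁ : s.card ≤ (Finset.Ici (s.min' hs)).card :=
          Finset.card_le_card fun i hi => Finset.mem_Ici.2 (s.min'_le i hi)
        rw [Fin.card_Ici] at h₁
        have h₂ := Finset.card_le_card
          (Finset.subset_biUnion_of_mem (fun i : Fin h.length => nbhd h i) (s.min'_mem hs))
        have h₃ := hn _ (s.min' hs).2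
        omega)
    have hinj : Function.Injective fun i : Fin h.length => ((i : ℕ), f i) := fun i j hij =>
      Fin.ext (Prod.mk.inj hij).1
    refine ⟨Finset.univ.image fun i : Fin h.length => ((i : ℕ), f i), ⟨?_, ?_, ?_⟩, ?_⟩
    · intro e he
      obtain ⟨i, -, rfl⟩ := Finset.mem_image.1 he
      exact ⟨i.2, hmem i⟩
    · intro e he e' he' hee
      obtain ⟨i, -, rfl⟩ := Finset.mem_image.1 (Finset.mem_coe.1 he)
      obtain ⟨i', -, rfl⟩ := Finset.mem_image.1 (Finset.mem_coe.1 he')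
      obtain rfl : i = i' := Fin.ext hee
      rfl
    · intro e he e' he' hee
      obtain ⟨i, -, rfl⟩ := Finset.mem_image.1 (Finset.mem_coe.1 he)
      obtain ⟨i', -, rfl⟩ := Finset.mem_image.1 (Finset.mem_coe.1 he')
      obtain rfl : i = i' := hf hee
      rfl
    · rw [Finset.card_image_of_injective _ hinj, Finset.card_univ, Fintype.card_fin]
  · rintro k ⟨M, hM, rfl⟩
    exact hM.card_le_length

end General

/-! ### A round of the balancing algorithm -/

section Round

variable {D : Type*} [DecidableEq D]

theorem Available.mono {m : ℕ → Finset D} {t : ℕ} {N S S' : Finset D} {d : D} (hS : S ⊆ S')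
    (hd : d ∉ S') (h : Available m t N S' d) : Available m t N S d := by
  refine ⟨h.1, fun x hx hxd => h.2 x hx ?_⟩
  ext y
  have := Finset.ext_iff.1 hxd y
  have := @hS y
  simp only [Finset.mem_sdiff, Finset.mem_singleton] at *
  grind

theorem Candidate.mono {m : ℕ → Finset D} {t : ℕ} {N S S' : Finset D} {e : ℕ} (hS : S ⊆ S')
    (h : Candidate m t N S' e) : Candidate m t N S e := by
  obtain ⟨het, ⟨d, hd, hav⟩, hcard⟩ := h
  obtain ⟨hd, hdS⟩ := Finset.mem_sdiff.1 hd
  refine ⟨het, ⟨d, Finset.mem_sdiff.2 ⟨hd, fun h => hdS (hS h)⟩, hav.mono hS hdS⟩, ?_⟩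
  have h₁ := Finset.card_le_card hS
  have h₂ := Finset.card_le_card (Finset.sdiff_subset_sdiff (Finset.Subset.refl (m e)) hS)
  omega

theorem BalStep.card_lt {m : ℕ → Finset D} {t : ℕ} {N S S' : Finset D}
    (h : BalStep m t N S S') : S.card < S'.card := by
  obtain ⟨e, -, -, d, hd, -, rfl⟩ := h
  rw [Finset.card_insert_of_notMem (Finset.mem_sdiff.1 hd).2]
  omega

theorem exists_steps_to_end [Fintype D] (m : ℕ → Finset D) (t : ℕ) (N S : Finset D) :
    ∃ S', Relation.ReflTransGen (BalStep m t N) S S' ∧ ∀ e, ¬ Candidate m t N S' e := by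
  induction hk : Fintype.card D - S.card using Nat.strong_induction_on generalizing S with
  | _ k ih =>
    by_cases hc : ∃ e, Candidate m t N S e
    · have hfin : {e | Candidate m t N S e}.Finite :=
        (Set.finite_Iio t).subset fun e he => he.1
      obtain ⟨e, he, hmax⟩ := Set.exists_max_image _ (fun e => (m e \ S).card) hfin hc
      obtain ⟨d, hd, hav⟩ := he.2.1
      have hstep : BalStep m t N S (insert d S) := ⟨e, he, hmax, d, hd, hav, rfl⟩
      have h₁ := hstep.card_lt
      have h₂ := Finset.card_le_univ (insert d S)
      obtain ⟨S', hS', hend⟩ := ih _ (by omega) (insert d S) rfl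
      exact ⟨S', hS'.head hstep, hend⟩
    · exact ⟨S, .refl, not_exists.1 hc⟩

theorem exists_balRound [Fintype D] (α : ℕ) (m : ℕ → Finset D) (t : ℕ) (N : Finset D) :
    ∃ S, BalRound α m t N S := by
  classical
  obtain ⟨S₀, hsub, hcard⟩ := Finset.exists_subset_card_eq
    (min_le_right α (Finset.univ.filter fun d => StronglyAvailable m t N d).card)
  obtain ⟨S, hS, hend⟩ := exists_steps_to_end m t N S₀
  refine ⟨S, ⟨S₀, ⟨fun d hd => (Finset.mem_filter.1 (hsub hd)).2, ?_⟩, hS⟩, hend⟩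
  rw [hcard]

theorem subset_of_steps {m : ℕ → Finset D} {t : ℕ} {N S₀ S : Finset D}
    (h : Relation.ReflTransGen (BalStep m t N) S₀ S) : S₀ ⊆ S := by
  induction h with
  | refl => exact Finset.Subset.refl _
  | tail _ hstep ih =>
    obtain ⟨e, -, -, d, -, -, rfl⟩ := hstep
    exact ih.trans (Finset.subset_insert d _)

/-- The loop always takes from a largest candidate. Hence, once something has been taken from `x`,
no remaining candidate exceeds `x` by more than one element, and `m(u)` does not outgrow `m(x)`. -/
theorem steps_lost {m : ℕ → Finset D} {t : ℕ} {N S₀ S : Finset D}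
    (hm : ∀ x y, x ≠ y → Disjoint (m x) (m y)) (h₀ : ∀ x < t, Disjoint (m x) S₀)
    (h : Relation.ReflTransGen (BalStep m t N) S₀ S) (x : ℕ) (hx : x < t)
    (hlost : ¬ Disjoint (m x) S) :
    S.card ≤ (m x \ S).card ∧ ∀ e, Candidate m t N S e → (m e \ S).card ≤ (m x \ S).card + 1 := by
  induction h with
  | refl => exact absurd (h₀ x hx) hlost
  | @tail S S' _ hstep ih =>
    obtain ⟨e, he, hmax, d, hd, hav, rfl⟩ := hstep
    have hdS := (Finset.mem_sdiff.1 hd).2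
    have hins : ∀ y, m y \ insert d S = (m y \ S).erase d := fun y => by
      ext; simp only [Finset.mem_sdiff, Finset.mem_insert, Finset.mem_erase]; tauto
    have hcand : ∀ e', Candidate m t N (insert d S) e' →
        Candidate m t N S e' ∧ (m e' \ insert d S).card ≤ (m e' \ S).card := fun e' he' =>
      ⟨he'.mono (Finset.subset_insert d S), by
        rw [hins]; exact Finset.card_le_card (Finset.erase_subset _ _)⟩
    rw [Finset.card_insert_of_notMem hdS]
    have hesize := he.2.2
    by_cases hxe : x = e
    · subst hxe
      have hcard : (m x \ insert d S).card + 1 = (m x \ S).card := by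
        rw [hins, Finset.card_erase_add_one hd]
      refine ⟨by omega, fun e' he' => ?_⟩
      obtain ⟨h₁, h₂⟩ := hcand e' he'
      have := hmax e' h₁
      omega
    · have hdx : d ∉ m x := fun h =>
        Finset.disjoint_left.1 (hm x e hxe) h (Finset.mem_sdiff.1 hd).1
      have hcard : m x \ insert d S = m x \ S := by
        rw [hins, Finset.erase_eq_of_notMem fun h => hdx (Finset.mem_sdiff.1 h).1]
      obtain ⟨h₁, h₂⟩ := ih fun h => hlost (Finset.disjoint_insert_right.2 ⟨hdx, h⟩)
      rw [hcard]
      have := h₂ e he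
      refine ⟨by omega, fun e' he' => ?_⟩
      obtain ⟨h₃, h₄⟩ := hcand e' he'
      have := h₂ e' h₃
      omega

/-- The outcome of a round of the balancing algorithm, as far as the analysis needs it: the vertex
`t` with neighbourhood `N` receives the set `S`, the groups of the earlier vertices being `m`. -/
structure IsBalanced (α : ℕ) (m : ℕ → Finset D) (t : ℕ) (N S : Finset D) : Prop where
  subset : S ⊆ N
  /-- A vertex which loses elements keeps at least as many as the new vertex gets. -/
  lost : ∀ x < t, ¬ Disjoint (m x) S → S.card ≤ (m x \ S).card
  /-- A neighbour outside all groups is refused only by a vertex with a full group. -/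
  free : ∀ d ∈ N, d ∉ S → (∀ x < t, d ∉ m x) → α ≤ S.card
  /-- A neighbour is left in its group only if that group is not much larger than `S`. -/
  left : ∀ e < t, ∀ d ∈ N, d ∈ m e \ S → (m e \ S).card ≤ S.card + 1

theorem BalRound.isBalanced [Fintype D] {α : ℕ} {m : ℕ → Finset D} {t : ℕ} {N S : Finset D}
    (h : BalRound α m t N S) (hm : ∀ x y, x ≠ y → Disjoint (m x) (m y)) :
    IsBalanced α m t N S := by
  classical
  obtain ⟨⟨S₀, ⟨hstrong, hcard⟩, hsteps⟩, hend⟩ := h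
  have h₀ : ∀ x < t, Disjoint (m x) S₀ := fun x hx =>
    Finset.disjoint_right.2 fun d hd => (hstrong d hd).2 x hx
  refine ⟨?_, fun x hx hl => (steps_lost hm h₀ hsteps x hx hl).1, ?_, ?_⟩
  · clear hend
    induction hsteps with
    | refl => exact fun d hd => (hstrong d hd).1.1
    | tail _ hstep ih =>
      obtain ⟨e, -, -, d, -, hav, rfl⟩ := hstep
      exact Finset.insert_subset hav.1 ih
  · intro d hdN hdS hfree
    have hsub := subset_of_steps hsteps
    by_contra! hlt
    have hlt₀ := (Finset.card_le_card hsub).trans_lt hlt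
    -- Fewer than `α` elements at the start: all the strongly available ones have been taken.
    have heq : S₀ = Finset.univ.filter fun d => StronglyAvailable m t N d := by
      refine Finset.eq_of_subset_of_card_le
        (fun d hd => Finset.mem_filter.2 ⟨Finset.mem_univ d, hstrong d hd⟩) ?_
      have : S₀.card = (Finset.univ.filter fun d => StronglyAvailable m t N d).card := by
        rcases min_choice α (Finset.univ.filter fun d => StronglyAvailable m t N d).card with h | h
        · rw [hcard, h] at hlt₀
          exact absurd hlt₀ (lt_irrefl α)
        · rw [hcard, h]
      exact this.ge
    refine hdS (hsub ?_)
    rw [heq]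
    refine Finset.mem_filter.2 ⟨Finset.mem_univ d, ⟨hdN, fun x hx hxd => hfree x hx ?_⟩, hfree⟩
    rw [Finset.sdiff_empty] at hxd
    rw [hxd]
    exact Finset.mem_singleton_self d
  · intro e he d hdN hd
    by_cases hav : Available m t N S d
    · have := hend e
      simp only [Candidate, not_and] at this
      have := this he ⟨d, hd, hav⟩
      omega
    · simp only [Available, not_and, not_forall, not_not] at hav
      obtain ⟨x, hx, hxd⟩ := hav hdN
      have hdx : d ∈ m x \ S := by rw [hxd]; exact Finset.mem_singleton_self d
      obtain rfl : x = e := by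
        by_contra hne
        exact Finset.disjoint_left.1 (hm x e hne) (Finset.mem_sdiff.1 hdx).1
          (Finset.mem_sdiff.1 hd).1
      rw [hxd, Finset.card_singleton]
      omega

theorem BalRound.card_le [Fintype D] {α : ℕ} {m : ℕ → Finset D} {t : ℕ} {N S : Finset D}
    (h : BalRound α m t N S) (hm : ∀ x, (m x).card ≤ α) : S.card ≤ α := by
  obtain ⟨⟨S₀, ⟨-, hcard⟩, hsteps⟩, -⟩ := h
  cases hsteps with
  | refl => rw [hcard]; exact min_le_left _ _
  | tail _ hstep =>
    obtain ⟨e, he, -, d, -, -, rfl⟩ := hstep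
    have h₁ := he.2.2.trans (Finset.card_le_card Finset.sdiff_subset)
    refine (Finset.card_insert_le d _).trans ?_
    have h₂ := hm e
    omega

end Round

/-! ### Groups of bounded size in games against the balancing algorithm -/

section Profile

variable {D : Type*}

/-- The number `K_j` of the vertices `x < t` whose groups have more than `j` elements. -/
def largeCount (m : ℕ → Finset D) (t j : ℕ) : ℕ :=
  ((Finset.range t).filter fun x => j < (m x).card).card

theorem largeCount_succ_le (m : ℕ → Finset D) (t j : ℕ) :
    largeCount m t (j + 1) ≤ largeCount m t j :=
  Finset.card_le_card <| Finset.monotone_filter_right _ fun _ _ hx => (Nat.lt_succ_self j).trans hx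

variable [DecidableEq D]

/-- The set `Z_j` of all elements which lie in a group of size at most `j` of a vertex `x < t`. -/
def smallUnion (m : ℕ → Finset D) (t j : ℕ) : Finset D :=
  ((Finset.range t).filter fun x => (m x).card ≤ j).biUnion m

theorem mem_smallUnion {m : ℕ → Finset D} {t j : ℕ} {d : D} :
    d ∈ smallUnion m t j ↔ ∃ x < t, (m x).card ≤ j ∧ d ∈ m x := by
  simp [smallUnion, and_assoc]

theorem smallUnion_mono (m : ℕ → Finset D) (t : ℕ) {i j : ℕ} (hij : i ≤ j) :
    smallUnion m t i ⊆ smallUnion m t j := fun d hd => by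
  obtain ⟨x, hx, hc, hd⟩ := mem_smallUnion.1 hd
  exact mem_smallUnion.2 ⟨x, hx, hc.trans hij, hd⟩

theorem smallUnion_zero (m : ℕ → Finset D) (t : ℕ) : smallUnion m t 0 = ∅ := by
  refine Finset.eq_empty_of_forall_notMem fun d hd => ?_
  obtain ⟨x, -, hc, hd⟩ := mem_smallUnion.1 hd
  rw [Finset.card_eq_zero.1 (Nat.le_zero.1 hc)] at hd
  exact Finset.notMem_empty d hd

theorem card_smallUnion_succ_le (m : ℕ → Finset D) (t j : ℕ) :
    (smallUnion m t (j + 1)).card ≤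
      (smallUnion m t j).card + (j + 1) * (largeCount m t j - largeCount m t (j + 1)) := by
  have hK : largeCount m t j = largeCount m t (j + 1) +
      ((Finset.range t).filter fun x => (m x).card = j + 1).card := by
    rw [largeCount, largeCount, ← Finset.card_union_of_disjoint]
    · congr 1
      ext x
      simp only [Finset.mem_filter, Finset.mem_union, ← and_or_left]
      refine and_congr_right fun _ => ?_
      omega
    · rw [Finset.disjoint_filter]
      intro x _ h h'
      omega
  have hsub : smallUnion m t (j + 1) ⊆ smallUnion m t j ∪
      ((Finset.range t).filter fun x => (m x).card = j + 1).biUnion m := by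
    intro d hd
    obtain ⟨x, hx, hc, hd⟩ := mem_smallUnion.1 hd
    rcases Nat.lt_or_eq_of_le hc with h | h
    · exact Finset.mem_union_left _ (mem_smallUnion.2 ⟨x, hx, by omega, hd⟩)
    · exact Finset.mem_union_right _ (Finset.mem_biUnion.2
        ⟨x, Finset.mem_filter.2 ⟨Finset.mem_range.2 hx, h⟩, hd⟩)
  refine (Finset.card_le_card hsub).trans ((Finset.card_union_le _ _).trans ?_)
  rw [hK, Nat.add_sub_cancel_left, mul_comm]
  refine Nat.add_le_add_left (Finset.card_biUnion_le_card_mul _ _ _ fun x hx => ?_) _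
  exact (Finset.mem_filter.1 hx).2.le

/-- `V` accounts for the vertices with a group of size at most `j` and a neighbour outside `Z_j`,
and each vertex in `V` can be charged to `j` elements of `Z_j`. -/
def IsCharged (nb m : ℕ → Finset D) (t j : ℕ) (V : Finset ℕ) : Prop :=
  j * V.card ≤ (smallUnion m t j).card ∧
    ∀ x < t, (m x).card ≤ j → nb x ⊆ smallUnion m t j ∨ x ∈ V

/-- Elements never leave `Z_j`, and if a vertex has to be added to `V`, then `j` new elements enter
`Z_j`: either the group of an old vertex falls from above `j` to at most `j`, or the new vertex
gets exactly `j` elements. -/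
theorem IsBalanced.exists_isCharged {α : ℕ} {nb nb' m m' : ℕ → Finset D} {t : ℕ} {N S : Finset D}
    (h : IsBalanced α m t N S) (hm : ∀ x y, x ≠ y → Disjoint (m x) (m y)) {j : ℕ} (hj : j ≤ α)
    (hnb : ∀ x < t, nb' x = nb x) (hnbt : nb' t = N)
    (hm' : ∀ x < t, m' x = m x \ S) (hmt : m' t = S)
    (hV : ∃ V, IsCharged nb m t j V) : ∃ V, IsCharged nb' m' (t + 1) j V := by
  obtain ⟨V, hcard, hcov⟩ := hV
  have hmem_old : ∀ x < t, (m x \ S).card ≤ j → m x \ S ⊆ smallUnion m' (t + 1) j :=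
    fun x hx hc d hd => mem_smallUnion.2 ⟨x, by omega, by rwa [hm' x hx], by rwa [hm' x hx]⟩
  have hmem_new : S.card ≤ j → S ⊆ smallUnion m' (t + 1) j :=
    fun hc d hd => mem_smallUnion.2 ⟨t, by omega, by rwa [hmt], by rwa [hmt]⟩
  have hmono : smallUnion m t j ⊆ smallUnion m' (t + 1) j := by
    intro d hd
    obtain ⟨x, hx, hc, hd⟩ := mem_smallUnion.1 hd
    have hle := (Finset.card_le_card (Finset.sdiff_subset : m x \ S ⊆ m x)).trans hc
    by_cases hdS : d ∈ S
    · exact hmem_new ((h.lost x hx (Finset.not_disjoint_iff.2 ⟨d, hd, hdS⟩)).trans hle) hdS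
    · exact hmem_old x hx hle (Finset.mem_sdiff.2 ⟨hd, hdS⟩)
  set C := (Finset.range t).filter fun x => j < (m x).card ∧ (m x \ S).card ≤ j with hC
  have hCmem : ∀ x ∈ C, x < t ∧ j < (m x).card ∧ (m x \ S).card ≤ j := fun x hx => by
    simpa [hC] using hx
  have hClost : ∀ x ∈ C, S.card ≤ (m x \ S).card := fun x hx => by
    obtain ⟨hxt, h₁, h₂⟩ := hCmem x hx
    refine h.lost x hxt fun hdis => ?_
    rw [Finset.sdiff_eq_self_of_disjoint hdis] at h₂
    omega
  -- A vertex with a large group shares no element with `Z_j`.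
  have hdisj : ∀ x ∈ C, Disjoint (smallUnion m t j) (m x) := by
    intro x hx
    refine Finset.disjoint_left.2 fun d hd hdx => ?_
    obtain ⟨y, hy, hc, hdy⟩ := mem_smallUnion.1 hd
    obtain ⟨-, h₁, -⟩ := hCmem x hx
    refine Finset.disjoint_left.1 (hm y x ?_) hdy hdx
    rintro rfl
    omega
  have hcov' : ∀ V', V ⊆ V' → C ⊆ V' → (∀ x < t, (m' x).card ≤ j →
      nb' x ⊆ smallUnion m' (t + 1) j ∨ x ∈ V') := by
    intro V' hVV' hCV' x hx hc
    rw [hm' x hx] at hc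
    by_cases hold : (m x).card ≤ j
    · rw [hnb x hx]
      exact (hcov x hx hold).imp (fun hs => hs.trans hmono) fun hs => hVV' hs
    · exact Or.inr (hCV' (Finset.mem_filter.2 ⟨Finset.mem_range.2 hx, not_le.1 hold, hc⟩))
  rcases lt_trichotomy S.card j with hlt | heq | hgt
  · refine ⟨V ∪ C, ?_, fun x hx hc => ?_⟩
    · have hsub : smallUnion m t j ∪ C.biUnion m ⊆ smallUnion m' (t + 1) j := by
        refine Finset.union_subset hmono (Finset.biUnion_subset.2 fun x hx d hd => ?_)
        by_cases hdS : d ∈ S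
        · exact hmem_new hlt.le hdS
        · exact hmem_old x (hCmem x hx).1 (hCmem x hx).2.2 (Finset.mem_sdiff.2 ⟨hd, hdS⟩)
      refine le_trans ?_ (Finset.card_le_card hsub)
      rw [Finset.card_union_of_disjoint ((Finset.disjoint_biUnion_right _ _ _).2 hdisj),
        Finset.card_biUnion fun x _ y _ hxy => hm x y hxy]
      have h₁ := Finset.card_nsmul_le_sum C (fun x => (m x).card) j fun x hx =>
        (hCmem x hx).2.1.le
      have h₂ := Nat.mul_le_mul_left j (Finset.card_union_le V C)
      rw [smul_eq_mul, mul_comm] at h₁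
      rw [mul_add] at h₂
      omega
    · rcases Nat.lt_succ_iff_lt_or_eq.1 hx with hx | rfl
      · exact hcov' _ Finset.subset_union_left Finset.subset_union_right x hx hc
      · -- The new vertex got fewer than `j ≤ α` elements, so all its neighbours lie in `Z_j`.
        refine Or.inl fun d hd => ?_
        rw [hnbt] at hd
        by_cases hdS : d ∈ S
        · exact hmem_new hlt.le hdS
        by_cases hfree : ∀ y < x, d ∉ m y
        · have := h.free d hd hdS hfree
          omega
        · push Not at hfree
          obtain ⟨e, he, hde⟩ := hfree
          have hde' := Finset.mem_sdiff.2 ⟨hde, hdS⟩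
          have := h.left e he d hd hde'
          exact hmem_old e he (by omega) hde'
  · refine ⟨insert t (V ∪ C), ?_, fun x hx hc => ?_⟩
    · have hsub : (smallUnion m t j ∪ C.biUnion fun x => m x \ S) ∪ S ⊆
          smallUnion m' (t + 1) j :=
        Finset.union_subset (Finset.union_subset hmono (Finset.biUnion_subset.2 fun x hx =>
          hmem_old x (hCmem x hx).1 (hCmem x hx).2.2)) (hmem_new heq.le)
      refine le_trans ?_ (Finset.card_le_card hsub)
      have hS : Disjoint (smallUnion m t j ∪ C.biUnion fun x => m x \ S) S := by
        refine Finset.disjoint_union_left.2 ⟨?_, (Finset.disjoint_biUnion_left _ _ _).2 fun x _ =>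
          Finset.sdiff_disjoint⟩
        refine Finset.disjoint_left.2 fun d hd hdS => ?_
        obtain ⟨x, hx, hc, hdx⟩ := mem_smallUnion.1 hd
        have h₁ := h.lost x hx (Finset.not_disjoint_iff.2 ⟨d, hdx, hdS⟩)
        have h₂ : (m x \ S).card < (m x).card := Finset.card_lt_card
          ⟨Finset.sdiff_subset, fun hs => (Finset.mem_sdiff.1 (hs hdx)).2 hdS⟩
        omega
      rw [Finset.card_union_of_disjoint hS, Finset.card_union_of_disjoint
          ((Finset.disjoint_biUnion_right _ _ _).2 fun x hx =>
            (hdisj x hx).mono_right Finset.sdiff_subset),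
        Finset.card_biUnion fun x _ y _ hxy =>
          (hm x y hxy).mono Finset.sdiff_subset Finset.sdiff_subset]
      have h₁ := Finset.card_nsmul_le_sum C (fun x => (m x \ S).card) j fun x hx =>
        heq ▸ hClost x hx
      have h₂ := Nat.mul_le_mul_left j ((Finset.card_insert_le t (V ∪ C)).trans
        (Nat.add_le_add_right (Finset.card_union_le V C) 1))
      rw [smul_eq_mul, mul_comm] at h₁
      rw [mul_add, mul_add] at h₂
      omega
    · rcases Nat.lt_succ_iff_lt_or_eq.1 hx with hx | rfl
      · exact hcov' _ (Finset.subset_union_left.trans (Finset.subset_insert _ _))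
          (Finset.subset_union_right.trans (Finset.subset_insert _ _)) x hx hc
      · exact Or.inr (Finset.mem_insert_self _ _)
  · refine ⟨V, hcard.trans (Finset.card_le_card hmono), fun x hx hc => ?_⟩
    rcases Nat.lt_succ_iff_lt_or_eq.1 hx with hx | rfl
    · refine hcov' V (Finset.Subset.refl V) (fun y hy => ?_) x hx hc
      have h₁ := hClost y hy
      have h₂ := (hCmem y hy).2.2
      omega
    · rw [hmt] at hc
      omega

theorem exists_isCharged {α : ℕ} {σ : Strategy D}
    (hσ : ∀ past N, IsBalanced α (groups σ past) past.length N (σ past N))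
    {j : ℕ} (hj : j ≤ α) (h : List (Finset D)) :
    ∃ V, IsCharged (nbhd h) (groups σ h) h.length j V := by
  induction h with
  | nil => exact ⟨∅, by simp, fun x hx => absurd hx (Nat.not_lt_zero x)⟩
  | cons N past ih =>
    refine (hσ past N).exists_isCharged (fun x y => disjoint_groups σ past) hj
      (fun x hx => ?_) ?_ (fun x hx => ?_) ?_ ih
    · simp [nbhd, hx.ne]
    · simp [nbhd]
    · simp [groups, hx.ne]
    · simp [groups]

/-- The number `Y_j` of the vertices with a neighbour outside `Z_j` exceeds `K_j` by at most
`|Z_j| / j`. -/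
theorem mul_card_not_subset_le {α : ℕ} {σ : Strategy D}
    (hσ : ∀ past N, IsBalanced α (groups σ past) past.length N (σ past N))
    {j : ℕ} (hj : j ≤ α) (h : List (Finset D)) :
    j * ((Finset.range h.length).filter fun x =>
        ¬ nbhd h x ⊆ smallUnion (groups σ h) h.length j).card ≤
      (smallUnion (groups σ h) h.length j).card + j * largeCount (groups σ h) h.length j := by
  obtain ⟨V, hcard, hcov⟩ := exists_isCharged hσ hj h
  have hsub : ((Finset.range h.length).filter fun x =>
      ¬ nbhd h x ⊆ smallUnion (groups σ h) h.length j) ⊆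
      V ∪ (Finset.range h.length).filter fun x => j < (groups σ h x).card := by
    intro x hx
    obtain ⟨hx, hns⟩ := Finset.mem_filter.1 hx
    by_cases hc : j < (groups σ h x).card
    · exact Finset.mem_union_right _ (Finset.mem_filter.2 ⟨hx, hc⟩)
    · exact Finset.mem_union_left _
        ((hcov x (Finset.mem_range.1 hx) (not_lt.1 hc)).resolve_left hns)
  have := Nat.mul_le_mul_left j ((Finset.card_le_card hsub).trans (Finset.card_union_le _ _))
  rw [mul_add] at this
  exact this.trans (Nat.add_le_add_right hcard _)

end Profile

/-! ### Builder's strategy against an arbitrary algorithm -/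

section Builder

/-- If all members of `A` have size at most `j`, then any `w` of them will do; otherwise a member of
size above `j` can be discarded. -/
theorem exists_subset_sum_le {ι : Type*} [DecidableEq ι] (f : ι → ℕ) {j w z : ℕ} (hz : j * w ≤ z)
    (A : Finset ι) (hw : w ≤ A.card) (hA : ∑ x ∈ A, f x ≤ z + (j + 1) * (A.card - w)) :
    ∃ G ⊆ A, G.card = w ∧ ∑ x ∈ G, f x ≤ z := by
  induction hk : A.card - w generalizing A with
  | zero => exact ⟨A, Finset.Subset.refl A, by omega, by simpa [hk] using hA⟩
  | succ k ih =>
    by_cases hbig : ∃ x ∈ A, j + 1 ≤ f x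
    · obtain ⟨x, hx, hfx⟩ := hbig
      have hc := Finset.card_erase_add_one hx
      have hs := Finset.sum_erase_add A f hx
      have hk' : (A.erase x).card - w = k := by omega
      rw [hk, mul_add] at hA
      obtain ⟨G, hG, h⟩ := ih (A.erase x) (by omega) (by rw [hk']; omega) hk'
      exact ⟨G, hG.trans (Finset.erase_subset x A), h⟩
    · push Not at hbig
      obtain ⟨G, hG, hcard⟩ := Finset.exists_subset_card_eq hw
      refine ⟨G, hG, hcard, (Finset.sum_le_card_nsmul G f j fun x hx => ?_).trans ?_⟩
      · have := hbig x (hG hx)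
        omega
      · rwa [hcard, smul_eq_mul, mul_comm]

variable {D : Type*} [DecidableEq D]

/-- Builder presents vertices with neighbourhood `E` until there are `y` vertices. Groups inside `E`
stay there. -/
theorem exists_extension {σ : Strategy D} (hσ : ∀ past N, σ past N ⊆ N) {n y : ℕ} (E : Finset D)
    (h : List (Finset D)) (hy : h.length ≤ y) (hn : n ≤ E.card + h.length)
    (hh : ∀ x < h.length, n ≤ (nbhd h x).card + x) :
    ∃ h' : List (Finset D), h'.length = y ∧ (∀ x < y, n ≤ (nbhd h' x).card + x) ∧
      ((Finset.range y).filter fun x => ¬ groups σ h' x ⊆ E).card ≤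
        ((Finset.range h.length).filter fun x => ¬ groups σ h x ⊆ E).card := by
  induction hk : y - h.length generalizing h with
  | zero =>
    obtain rfl : h.length = y := by omega
    exact ⟨h, rfl, hh, le_rfl⟩
  | succ k ih =>
    obtain ⟨h', hlen, hnb, hc⟩ := ih (E :: h) (by simp only [List.length_cons]; omega)
      (by simp only [List.length_cons]; omega) (fun x hx => by
        simp only [List.length_cons] at hx
        simp only [nbhd]
        split_ifs with hxh
        · omega
        · exact hh x (by omega)) (by simp only [List.length_cons]; omega)
    refine ⟨h', hlen, hnb, hc.trans (Finset.card_le_card (Finset.subset_iff.2 fun x hx => ?_))⟩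
    obtain ⟨hx, hns⟩ := Finset.mem_filter.1 hx
    rw [Finset.mem_range, List.length_cons] at hx
    rw [Finset.mem_filter, Finset.mem_range]
    simp only [groups] at hns
    split_ifs at hns with hxh
    · exact absurd (hσ h E) hns
    · exact ⟨by omega, fun hs => hns (Finset.sdiff_subset.trans hs)⟩

/-- A phase of Builder's strategy. Builder presents vertices with neighbourhood `E` until there are
`y` of them, and then shrinks `E` to a set `E'` of `z'` elements such that at most `K'`
groups are not contained in `E'`: `E'` includes `y' - K'` groups of total size at most `z'`. -/
theorem exists_phase {σ : Strategy D} (hσ : ∀ past N, σ past N ⊆ N) {n j y y' z' K K' : ℕ}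
    {E : Finset D} {h : List (Finset D)} (hlen : h.length = y) (hyy' : y ≤ y')
    (hz : z' ≤ E.card) (hE : E.card ≤ z' + (j + 1) * (K' - K)) (hKK' : K ≤ K')
    (hy' : j * y' ≤ z' + j * K') (hn : n ≤ E.card + y)
    (hc : ((Finset.range y).filter fun x => ¬ groups σ h x ⊆ E).card ≤ K)
    (hh : ∀ x < y, n ≤ (nbhd h x).card + x) :
    ∃ (h' : List (Finset D)) (E' : Finset D), h'.length = y' ∧ E'.card = z' ∧
      ((Finset.range y').filter fun x => ¬ groups σ h' x ⊆ E').card ≤ K' ∧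
      ∀ x < y', n ≤ (nbhd h' x).card + x := by
  subst hlen
  obtain ⟨h', hlen', hh', hc'⟩ := exists_extension hσ E h hyy' hn hh
  have hcK := hc'.trans hc
  have hA := Finset.card_filter_add_card_filter_not (s := Finset.range y')
    (fun x => groups σ h' x ⊆ E)
  rw [Finset.card_range] at hA
  set A := (Finset.range y').filter fun x => groups σ h' x ⊆ E
  have hdisj : ∀ B : Finset ℕ, (B.biUnion (groups σ h')).card = ∑ x ∈ B, (groups σ h' x).card :=
    fun B => Finset.card_biUnion fun x _ y _ hxy => disjoint_groups σ h' hxy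
  have hAE : A.biUnion (groups σ h') ⊆ E :=
    Finset.biUnion_subset.2 fun x hx => (Finset.mem_filter.1 hx).2
  obtain ⟨G, hGA, hG, hsum⟩ : ∃ G ⊆ A, G.card = y' - K' ∧ ∑ x ∈ G, (groups σ h' x).card ≤ z' := by
    rcases le_or_gt y' K' with hle | hgt
    · exact ⟨∅, Finset.empty_subset A, by simp; omega, by simp⟩
    · refine exists_subset_sum_le (j := j) _ ?_ A (by omega) ?_
      · rw [Nat.mul_sub]
        omega
      · rw [← hdisj]
        refine (Finset.card_le_card hAE).trans (hE.trans ?_)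
        exact Nat.add_le_add_left (Nat.mul_le_mul_left _ (by omega)) _
  obtain ⟨E', hGE', -, hE'⟩ := Finset.exists_subsuperset_card_eq
    ((Finset.biUnion_subset_biUnion_of_subset_left _ hGA).trans hAE) ((hdisj G).trans_le hsum) hz
  refine ⟨h', E', hlen', hE', ?_, hh'⟩
  have hGy : G ⊆ Finset.range y' := hGA.trans (Finset.filter_subset _ _)
  have hsub : ((Finset.range y').filter fun x => ¬ groups σ h' x ⊆ E') ⊆ Finset.range y' \ G := by
    intro x hx
    obtain ⟨hx, hns⟩ := Finset.mem_filter.1 hx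
    exact Finset.mem_sdiff.2 ⟨hx, fun hxG =>
      hns ((Finset.subset_biUnion_of_mem (groups σ h') hxG).trans hGE')⟩
  have := Finset.card_le_card hsub
  rw [Finset.card_sdiff_of_subset hGy, Finset.card_range] at this
  omega

/-- Builder's strategy as a whole. For `j = α, …, 0` the set of active elements has
`z j` elements after `min (Y j) n` vertices, and at most `K j` groups are not contained in it. -/
theorem exists_play [Fintype D] {α n : ℕ} {σ : Strategy D} (hsub : ∀ past N, σ past N ⊆ N)
    (hcard : ∀ past N, (σ past N).card ≤ α) {z Y K : ℕ → ℕ} (hD : z α + n ≤ Fintype.card D)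
    (hz₀ : z 0 = 0) (hz : ∀ j, z j ≤ z (j + 1))
    (hzK : ∀ j, z (j + 1) ≤ z j + (j + 1) * (K j - K (j + 1))) (hK : ∀ j, K (j + 1) ≤ K j)
    (hKα : K α = 0) (hY : ∀ j, Y (j + 1) ≤ Y j) (hYz : ∀ j ≤ α, j * Y j ≤ z j + j * K j)
    (hn : ∀ j, n ≤ z j + Y j) :
    ∃ h : List (Finset D), HasSize h n ∧ matched σ h ≤ K 0 := by
  have key : ∀ j ≤ α, ∃ (h : List (Finset D)) (E : Finset D), h.length = min (Y j) n ∧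
      E.card = z j ∧
      ((Finset.range (min (Y j) n)).filter fun x => ¬ groups σ h x ⊆ E).card ≤ K j ∧
      ∀ x < min (Y j) n, n ≤ (nbhd h x).card + x := by
    intro j hj
    induction hj using Nat.decreasingInduction with
    | self =>
      obtain ⟨h, hlen, hh, -⟩ := exists_extension hsub (n := n) (y := min (Y α) n)
        (Finset.univ : Finset D) [] (Nat.zero_le _) (by rw [Finset.card_univ]; omega)
        (fun x hx => absurd hx (Nat.not_lt_zero x))
      have hle : ((Finset.range (min (Y α) n)).biUnion (groups σ h)).card ≤ z α := by
        refine (Finset.card_biUnion_le_card_mul _ _ α fun x _ =>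
          card_groups_le hcard h x).trans ?_
        rw [Finset.card_range, mul_comm]
        have := hYz α le_rfl
        rw [hKα, mul_zero, add_zero] at this
        exact (Nat.mul_le_mul_left α (min_le_left _ _)).trans this
      obtain ⟨E, hE, hEc⟩ := Finset.exists_superset_card_eq hle (by omega)
      refine ⟨h, E, hlen, hEc, ?_, hh⟩
      rw [hKα, Nat.le_zero, Finset.card_eq_zero, Finset.filter_eq_empty_iff]
      exact fun x hx => not_not.2 ((Finset.subset_biUnion_of_mem (groups σ h) hx).trans hE)
    | of_succ j hj ih =>
      obtain ⟨h, E, hlen, hE, hc, hh⟩ := ih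
      refine exists_phase (j := j) hsub hlen (min_le_min_right n (hY j)) (by rw [hE]; exact hz j)
        (by rw [hE]; exact hzK j) (hK j)
        ((Nat.mul_le_mul_left j (min_le_left _ _)).trans (hYz j hj.le)) ?_ hc hh
      have := hn (j + 1)
      rw [hE]
      omega
  obtain ⟨h, E, hlen, hE, hc, hh⟩ := key 0 (Nat.zero_le α)
  have hn₀ := hn 0
  rw [min_eq_right (by omega)] at hlen hc hh
  subst hlen
  refine ⟨h, hasSize_length h hh, le_trans (Finset.card_le_card fun x hx => ?_) hc⟩
  rw [hz₀, Finset.card_eq_zero] at hE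
  subst hE
  obtain ⟨hx, hne⟩ := Finset.mem_filter.1 hx
  exact Finset.mem_filter.2 ⟨hx, fun hs => hne.ne_empty (Finset.subset_empty.1 hs)⟩

end Builder

/-! ### Optimality -/

theorem IsBal.isLazy {α : ℕ} {A : Algorithm} (hA : IsBal α A) : IsLazy α A := by
  intro d past N
  refine ⟨((hA d past N).isBalanced fun x y => disjoint_groups _ past).subset, ?_⟩
  refine (hA d past N).card_le fun x => ?_
  clear N
  induction past generalizing x with
  | nil => simp [groups]
  | cons N past ih =>
    simp only [groups]
    split_ifs
    · exact (hA d past N).card_le ih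
    · exact (Finset.card_le_card Finset.sdiff_subset).trans (ih x)

/-- Whatever Builder achieves against the balancing algorithm, he achieves against any other
algorithm in a game of the same size. -/
theorem IsBal.exists_matched_le {α : ℕ} {A B : Algorithm} (hA : IsBal α A) (hB : IsLazy α B)
    {d n : ℕ} {h : List (Finset (Fin d))} (hn : HasSize h n) :
    ∃ (d' : ℕ) (h' : List (Finset (Fin d'))),
      HasSize h' n ∧ matched (B d') h' ≤ matched (A d) h := by
  have hbal : ∀ past N, IsBalanced α (groups (A d) past) past.length N (A d past N) :=
    fun past N => (hA d past N).isBalanced fun x y => disjoint_groups _ past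
  set g := groups (A d) h
  set t := h.length
  obtain ⟨⟨M, hM, rfl⟩, -⟩ := hn
  obtain ⟨h', hsize, hle⟩ := exists_play (D := Fin ((smallUnion g t α).card + M.card)) (n := M.card)
    (fun past N => (hB _ past N).1) (fun past N => (hB _ past N).2)
    (z := fun j => (smallUnion g t j).card)
    (Y := fun j => ((Finset.range t).filter fun x => ¬ nbhd h x ⊆ smallUnion g t j).card)
    (K := largeCount g t) (by rw [Fintype.card_fin])
    (by rw [smallUnion_zero, Finset.card_empty])
    (fun j => Finset.card_le_card (smallUnion_mono g t j.le_succ))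
    (card_smallUnion_succ_le g t) (largeCount_succ_le g t)
    (by
      rw [largeCount, Finset.card_eq_zero, Finset.filter_eq_empty_iff]
      exact fun x _ => not_lt.2 (card_groups_le (fun past N => (hA.isLazy d past N).2) h x))
    (fun j => Finset.card_le_card <| Finset.monotone_filter_right _ fun x _ hx hs =>
      hx (hs.trans (smallUnion_mono g t j.le_succ)))
    (fun j hj => mul_card_not_subset_le hbal hj h)
    (fun j => hM.card_le_cover (smallUnion g t j))
  refine ⟨_, h', hsize, hle.trans (Finset.card_le_card fun x hx => ?_)⟩
  obtain ⟨hx, hpos⟩ := Finset.mem_filter.1 hx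
  exact Finset.mem_filter.2 ⟨hx, Finset.card_pos.1 hpos⟩

theorem exists_hasSize (n : ℕ) : ∃ (d : ℕ) (h : List (Finset (Fin d))), HasSize h n := by
  obtain ⟨h, hlen, hh, -⟩ := exists_extension (σ := fun _ N => N) (fun _ N => Finset.Subset.refl N)
    (n := n) (y := n) (Finset.univ : Finset (Fin n)) [] (Nat.zero_le _) (by simp)
    (fun x hx => absurd hx (Nat.not_lt_zero x))
  have := hasSize_length h (by rwa [hlen])
  rw [hlen] at this
  exact ⟨n, h, this⟩

theorem exists_isWorstValue (A : Algorithm) (n : ℕ) : ∃ v, IsWorstValue A n v := by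
  obtain ⟨d, h, hh⟩ := exists_hasSize n
  have hne : {k | ∃ (d : ℕ) (h : List (Finset (Fin d))),
      HasSize h n ∧ matched (A d) h = k}.Nonempty := ⟨_, d, h, hh, rfl⟩
  exact ⟨_, Nat.sInf_mem hne, fun k hk => Nat.sInf_le hk⟩

/-- The groups that arise if every round is played by the rule `r`: the vertex `t` with neighbourhood
`N` receives the set `r m t N`, where `m` are the current groups. -/
def groupsOfRule {D : Type*} [DecidableEq D] (r : (ℕ → Finset D) → ℕ → Finset D → Finset D) :
    List (Finset D) → ℕ → Finset D
  | [] => fun _ => ∅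
  | N :: past => fun x =>
      if x = past.length then r (groupsOfRule r past) past.length N
      else groupsOfRule r past x \ r (groupsOfRule r past) past.length N

theorem groups_eq_groupsOfRule {D : Type*} [DecidableEq D]
    (r : (ℕ → Finset D) → ℕ → Finset D → Finset D) (h : List (Finset D)) :
    groups (fun past N => r (groupsOfRule r past) past.length N) h = groupsOfRule r h := by
  induction h with
  | nil => rfl
  | cons N past ih =>
    funext x
    simp only [groups, groupsOfRule, ih]

theorem exists_isBal (α : ℕ) : ∃ A : Algorithm, IsBal α A := by
  choose r hr using fun (d : ℕ) (m : ℕ → Finset (Fin d)) => exists_balRound α m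
  refine ⟨fun d past N => r d (groupsOfRule (r d) past) past.length N, fun d past N => ?_⟩
  rw [groups_eq_groupsOfRule]
  exact hr _ _ _ _

end LazyMatching

theorem theorem1 (α : ℕ) (hα : 1 ≤ α) :
    (∃ A : LazyMatching.Algorithm, LazyMatching.IsBal α A) ∧
    ∀ A : LazyMatching.Algorithm, LazyMatching.IsBal α A →
      LazyMatching.IsLazy α A ∧
      ∀ n : ℕ, ∃ v : ℕ, LazyMatching.IsWorstValue A n v ∧ LazyMatching.IsLazyValue α n v := by
  refine ⟨LazyMatching.exists_isBal α, fun A hA => ⟨hA.isLazy, fun n => ?_⟩⟩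
  obtain ⟨v, hv⟩ := LazyMatching.exists_isWorstValue A n
  refine ⟨v, hv, ⟨A, hA.isLazy, hv⟩, ?_⟩
  rintro w ⟨B, hB, hw⟩
  obtain ⟨d, h, hh, rfl⟩ := hv.1
  obtain ⟨d', h', hh', hle⟩ := hA.exists_matched_le hB hh
  exact (hw.2 ⟨d', h', hh', rfl⟩).trans hle
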